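/- There is a universal constant $c>0$ such that the following holds. For a positive integer $k$ let $\mathcal C_k$ be the collection of all subsets of $\mathbb R$ that are unions of $k$ intervals (of any type: open, closed or half-open, bounded or unbounded, possibly degenerate or empty), let $\mathrm{vol}$ be Lebesgue measure, and for a probability measure $Q$ on $\mathbb R$ and $t\in\mathbb R$ let $\mathrm{OPT}_k(Q,t)=\inf\{\mathrm{vol}(C): C\in\mathcal C_k,\ Q(C)\ge t\}\in[0,\infty]$, with $\inf\emptyset=\infty$. Let $n,m,k\ge 1$ be integers, and let $\alpha\in(0,1)$ and $\delta,\gamma\in\mathbb R$ satisfy $$3\delta+\gamma+\tfrac1n\le\alpha,\qquad \delta\ \ge\ c\,\sqrt{\frac{k+\log n}{n}}.$$ Let $Y_1,\dots,Y_{2n+1}$ be i.i.d. real random variables with an arbitrary distribution $P$ on $\mathbb R$, and let $\mathbb P_n=\frac1n\sum_{i=1}^n\delta_{Y_i}$ be the empirical distribution of the first $n$ of them. Let $S_1,\dots,S_m\subseteq\mathbb R$ be random sets that are measurable functions of $(Y_1,\dots,Y_n)$, in the sense that $S_j=S_j(Y_1,\dots,Y_n)$ with $\{(y,x)\in\mathbb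 R^n\times\mathbb R: x\in S_j(y)\}$ Borel for every $j$. Assume that almost surely * $S_1\subseteq\cdots\subseteq S_m$, and $S_j\in\mathcal C_k$ and $\mathbb P_n(S_j)=j/m$ for all $1\le j\le m$; * there is some $j^*\in\{1,\dots,m\}$ (which may depend on the data) such that $\mathbb P_n(S_{j^*})\ge 1-\alpha+\frac1n+3\delta$ and $\mathrm{vol}(S_{j^*})\le \mathrm{OPT}_k\bigl(\mathbb P_n,\,1-\alpha+\frac1n+3\delta+\gamma\bigr)$. Define the conformity score $q(y)=\sum_{j=1}^m\mathbb 1\{y\in S_j\}$, let $q_1\le\cdots\le q_n$ be the values $q(Y_{n+1}),\dots,q(Y_{2n})$ in nondecreasing order, and let $\widehat C=\{y\in\mathbb R: q(y)\ge q_{\lfloor (n+1)\alpha\rfloor}\}$ be the split conformal prediction set. Then: 1. (Coverage) $\mathbb P\bigl(Y_{2n+1}\in\widehat C\bigr)\ge 1-\alpha$. 2. (Restricted volume optimality) With probability at least $1-2\delta$, $$\mathrm{vol}(\widehat C)\ \le\ \mathrm{OPT}_k\Bigl(P,\ 1-\alpha+\tfrac1n+4\delta+\gamma\Bigr).$$ 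-/

import Mathlib

open MeasureTheory ProbabilityTheory

noncomputable section

namespace ConformalDP

/-- The collection `𝒞_k` of all subsets of `ℝ` that are unions of `k` intervals. An interval is an
order-connected subset of `ℝ`: open, closed, half-open, bounded or unbounded, possibly a single
point or empty. -/
def unionsOfIntervals (k : ℕ) : Set (Set ℝ) :=
  {C | ∃ I : Fin k → Set ℝ, (∀ i, (I i).OrdConnected) ∧ C = ⋃ i, I i}

/-- The restricted optimal volume `OPT_k(Q, t) = inf {vol(C) : C ∈ 𝒞_k, Q(C) ≥ t}`, as an
extended nonnegative real; it is `∞` when no `C ∈ 𝒞_k` satisfies `Q(C) ≥ t`. -/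
def optVol (k : ℕ) (Q : Measure ℝ) (t : ℝ) : ENNReal :=
  ⨅ C ∈ {C : Set ℝ | C ∈ unionsOfIntervals k ∧ t ≤ Q.real C}, volume C

/-- The empirical distribution `(1/n) ∑ δ_{y_i}` of the points `y_1, …, y_n`. -/
def empirical {n : ℕ} (y : Fin n → ℝ) : Measure ℝ :=
  (n : ENNReal)⁻¹ • ∑ i, Measure.dirac (y i)

/-- The requirements on a nested system `S_1 ⊆ ⋯ ⊆ S_m` built from the sample `y_1, …, y_n`.
The sets are indexed by `Fin m`, so that `S j` is the set with number `j + 1`. -/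
structure IsNestedSystem {n m : ℕ} (k : ℕ) (α δ γ : ℝ) (y : Fin n → ℝ) (S : Fin m → Set ℝ) :
    Prop where
  nested : Monotone S
  mem_unions : ∀ j, S j ∈ unionsOfIntervals k
  empirical_eq : ∀ j, (empirical y).real (S j) = ((j : ℝ) + 1) / m
  exists_good : ∃ j,
    1 - α + 1 / n + 3 * δ ≤ (empirical y).real (S j) ∧
    volume (S j) ≤ optVol k (empirical y) (1 - α + 1 / n + 3 * δ + γ)

/-- The conformity score `q(x) = ∑_j 1{x ∈ S_j}`. -/
def score {m : ℕ} (S : Fin m → Set ℝ) (x : ℝ) : ℕ :=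
  ∑ j, (S j).indicator (fun _ => (1 : ℕ)) x

/-- The `r`-th smallest entry (`1 ≤ r ≤ n`, counted with multiplicity) of `v_1, …, v_n`; the value
is `0` for `r` outside this range. -/
def orderStat {n : ℕ} (v : Fin n → ℕ) (r : ℕ) : ℕ :=
  if h : 1 ≤ r ∧ r ≤ n then v (Tuple.sort v ⟨r - 1, by omega⟩) else 0

/-- The split conformal prediction set `{x : q(x) ≥ q_{⌊(n+1)α⌋}}`, where `q` is the score of the
nested system `S` and `q_1 ≤ ⋯ ≤ q_n` are the ordered scores of the calibration points `z`. -/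
def predictionSet {n m : ℕ} (α : ℝ) (S : Fin m → Set ℝ) (z : Fin n → ℝ) : Set ℝ :=
  {x | orderStat (fun i => score S (z i)) ⌊((n : ℝ) + 1) * α⌋₊ ≤ score S x}

/-- The first `n` of `2n + 1` observations. -/
def firstHalf {n : ℕ} (y : Fin (2 * n + 1) → ℝ) : Fin n → ℝ :=
  fun i => y ⟨i, by omega⟩

/-- The observations number `n + 1, …, 2n` of `2n + 1` observations. -/
def secondHalf {n : ℕ} (y : Fin (2 * n + 1) → ℝ) : Fin n → ℝ :=
  fun i => y ⟨n + i, by omega⟩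

/-- The split conformal prediction set computed from the observations number `1, …, 2n`: the nested
system `S` is evaluated on the first half and calibrated on the second half. -/
def splitConformalSet {n m : ℕ} (α : ℝ) (S : Fin m → (Fin n → ℝ) → Set ℝ)
    (y : Fin (2 * n + 1) → ℝ) : Set ℝ :=
  predictionSet α (fun j => S j (firstHalf y)) (secondHalf y)

end ConformalDP

end

/-! Coverage is exchangeability. Given the first half of the sample, the `n + 1` later scores are
exchangeable. If the last observation is missed, at most `r = ⌊(n + 1)α⌋` of these scores are at
most its own. At most `r` indices can have such a low rank, so by symmetry the miss has probability
at most `r / (n + 1) ≤ α` (`card_low_rank_le`, `measure_lowRank_eq`).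

For the volume, suppose that no union of `k` intervals contains over `3δn` more points of the first
half than of the second. Then the good set `S j` still holds so many calibration points that the
prediction set lies inside it (`predictionSet_subset`), and its volume is at most the empirical
optimum. Hoeffding's inequality along a minimizing sequence for `P` compares this with the optimum
for `P` at a level higher by `δ`. Each of the two events fails with probability at most `δ`.

The uniform bound must avoid the factor `log n` in front of `k` that a plain union bound over traces
would give. Random swaps between the halves reduce it to Rademacher sums for a fixed sample. Only
ranks matter there, and a union of `k` intervals cuts out a set of ranks with at most `2k` run ends.
Such a set splits, at each dyadic scale, into at most `2k` blocks (`sum_le_sum_of_block_sums_le`).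
The variance halves from one scale to the next while the log-count of choices grows only linearly,
so the union bound over scales converges (`card_bad_signs_le`). -/

namespace ConformalDP

/-! ### Rademacher sums -/

/-- The sign attached to a Boolean: `true` stands for a swap. -/
def sgn (b : Bool) : ℝ := if b then -1 else 1

lemma sum_exp_sgn_le {ι : Type*} [Fintype ι] [DecidableEq ι] (a : ι → ℝ) :
    ∑ ε : ι → Bool, Real.exp (∑ i, sgn (ε i) * a i) ≤
      2 ^ Fintype.card ι * Real.exp ((∑ i, a i ^ 2) / 2) := by
  have h1 : ∑ ε : ι → Bool, Real.exp (∑ i, sgn (ε i) * a i) =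
      ∏ i, ∑ b : Bool, Real.exp (sgn b * a i) := by
    rw [Finset.prod_univ_sum, Fintype.piFinset_univ]
    exact Finset.sum_congr rfl fun ε _ => Real.exp_sum _ _
  have h2 : ∀ i, ∑ b : Bool, Real.exp (sgn b * a i) ≤ 2 * Real.exp (a i ^ 2 / 2) := by
    intro i
    have := Real.cosh_le_exp_half_sq (a i)
    rw [Real.cosh_eq] at this
    simp [sgn]
    linarith
  rw [h1]
  refine (Finset.prod_le_prod (fun i _ => by positivity) fun i _ => h2 i).trans_eq ?_
  rw [Finset.prod_mul_distrib, ← Real.exp_sum, Finset.sum_div]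
  simp

/-- Chernoff's bound with the optimal exponent `u / v`, written as a count of sign vectors. -/
lemma card_rademacher_tail_le {ι : Type*} [Fintype ι] [DecidableEq ι] (a : ι → ℝ) {u v : ℝ}
    (hv : 0 < v) (hu : 0 ≤ u) (ha : ∑ i, a i ^ 2 ≤ v) :
    ((Finset.univ.filter fun ε : ι → Bool => u ≤ ∑ i, sgn (ε i) * a i).card : ℝ) ≤
      2 ^ Fintype.card ι * Real.exp (-(u ^ 2 / (2 * v))) := by
  set F := Finset.univ.filter fun ε : ι → Bool => u ≤ ∑ i, sgn (ε i) * a i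
  have h1 : (F.card : ℝ) * Real.exp (u / v * u) ≤
      ∑ ε : ι → Bool, Real.exp (∑ i, sgn (ε i) * (u / v * a i)) := by
    rw [← nsmul_eq_mul]
    refine (Finset.card_nsmul_le_sum F _ _ ?_).trans
      (Finset.sum_le_sum_of_subset_of_nonneg (Finset.subset_univ F) fun _ _ _ => by positivity)
    intro ε hε
    rw [Real.exp_le_exp]
    have : ∑ i, sgn (ε i) * (u / v * a i) = u / v * ∑ i, sgn (ε i) * a i := by
      rw [Finset.mul_sum]
      exact Finset.sum_congr rfl fun i _ => by ring
    rw [this]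
    exact mul_le_mul_of_nonneg_left (Finset.mem_filter.1 hε).2 (by positivity)
  have h2 := h1.trans (sum_exp_sgn_le fun i => u / v * a i)
  have h3 : (∑ i, (u / v * a i) ^ 2) / 2 ≤ u / v * u - u ^ 2 / (2 * v) := by
    have : ∑ i, (u / v * a i) ^ 2 = (u / v) ^ 2 * ∑ i, a i ^ 2 := by
      rw [Finset.mul_sum]
      exact Finset.sum_congr rfl fun i _ => by ring
    rw [this]
    have h4 : (u / v) ^ 2 * ∑ i, a i ^ 2 ≤ (u / v) ^ 2 * v := by gcongr
    have h5 : u / v * u - u ^ 2 / (2 * v) = (u / v) ^ 2 * v / 2 := by field_simp; ring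
    rw [h5]
    linarith
  have h6 : (2 : ℝ) ^ Fintype.card ι * Real.exp ((∑ i, (u / v * a i) ^ 2) / 2) ≤
      2 ^ Fintype.card ι * Real.exp (-(u ^ 2 / (2 * v))) * Real.exp (u / v * u) := by
    rw [mul_assoc, ← Real.exp_add]
    gcongr
    linarith
  exact le_of_mul_le_mul_right (h2.trans h6) (Real.exp_pos _)

/-! ### Counting small subsets -/

/-- Give a subset `U` the weight `x ^ U.card` with `x = 2⁻ʲ`. All weights together sum to `(1 + x) ^
(D * 2 ^ j) ≤ exp D`, and each subset counted here weighs at least `x ^ D ≥ exp (-(D * j))`. -/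
lemma card_subsets_card_le (D j : ℕ) :
    (((Finset.range (D * 2 ^ j)).powerset.filter fun U => U.card ≤ D).card : ℝ) ≤
      Real.exp (D * (1 + j)) := by
  set G := (Finset.range (D * 2 ^ j)).powerset.filter fun U => U.card ≤ D
  set x : ℝ := (2 ^ j)⁻¹ with hx
  have hx0 : 0 < x := by positivity
  have hx1 : x ≤ 1 := inv_le_one_of_one_le₀ (one_le_pow₀ (by norm_num))
  have h1 : (G.card : ℝ) * x ^ D ≤ (x + 1) ^ (D * 2 ^ j) := by
    have h := Finset.sum_pow_mul_eq_add_pow x 1 (Finset.range (D * 2 ^ j))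
    rw [Finset.card_range] at h
    rw [← h, ← nsmul_eq_mul]
    refine (Finset.card_nsmul_le_sum G (fun U => x ^ U.card * 1 ^ (D * 2 ^ j - U.card)) _ ?_).trans
      (Finset.sum_le_sum_of_subset_of_nonneg (Finset.filter_subset _ _)
        fun _ _ _ => by positivity)
    intro U hU
    rw [one_pow, mul_one]
    exact pow_le_pow_of_le_one hx0.le hx1 (Finset.mem_filter.1 hU).2
  have h2 : (x + 1) ^ (D * 2 ^ j) ≤ Real.exp D := by
    calc (x + 1) ^ (D * 2 ^ j) ≤ Real.exp x ^ (D * 2 ^ j) := by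
          gcongr; exact Real.add_one_le_exp x
      _ = Real.exp D := by
          rw [← Real.exp_nat_mul, hx]
          congr 1
          push_cast
          field_simp
  have h3 : Real.exp (-(D * j)) ≤ x ^ D := by
    have : Real.exp (-(j : ℝ)) ≤ x := by
      rw [hx, Real.exp_neg]
      apply inv_anti₀ (by positivity)
      have h2e : (2 : ℝ) ≤ Real.exp 1 := by
        have := Real.add_one_le_exp (1 : ℝ); linarith
      calc (2 : ℝ) ^ j ≤ Real.exp 1 ^ j := by gcongr
        _ = Real.exp j := by rw [← Real.exp_nat_mul, mul_one]
    calc Real.exp (-(D * j)) = Real.exp (-(j : ℝ)) ^ D := by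
          rw [← Real.exp_nat_mul]; congr 1; ring
      _ ≤ x ^ D := by gcongr
  have h4 : (G.card : ℝ) * Real.exp (-(D * j)) ≤ Real.exp D :=
    (mul_le_mul_of_nonneg_left h3 (by positivity)).trans (h1.trans h2)
  calc (G.card : ℝ) = G.card * Real.exp (-(D * j)) * Real.exp (D * j) := by
        rw [mul_assoc, ← Real.exp_add]; simp
    _ ≤ Real.exp D * Real.exp (D * j) := by gcongr
    _ = Real.exp (D * (1 + j)) := by rw [← Real.exp_add]; congr 1; ring

/-! ### Dyadic chaining -/

/-- Right ends of the maximal runs of consecutive numbers in `T`. -/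
def rightEnds (T : Finset ℕ) : Finset ℕ := T.filter fun r => r + 1 ∉ T

/-- Left ends, other than `0`, of the maximal runs of consecutive numbers in `T`. -/
def leftEnds (T : Finset ℕ) : Finset ℕ := T.filter fun r => r ≠ 0 ∧ r - 1 ∉ T

lemma sum_range_two_mul (f : ℕ → ℝ) (M : ℕ) :
    ∑ r ∈ Finset.range (2 * M), f r = ∑ c ∈ Finset.range M, (f (2 * c) + f (2 * c + 1)) := by
  induction M with
  | zero => simp
  | succ M ih =>
    rw [show 2 * (M + 1) = 2 * M + 1 + 1 by ring, Finset.sum_range_succ, Finset.sum_range_succ, ih,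
      Finset.sum_range_succ]
    ring

lemma sum_filter_div_two (f : ℕ → ℝ) (M : ℕ) (p : ℕ → Prop) [DecidablePred p] :
    ∑ c ∈ (Finset.range M).filter p, (f (2 * c) + f (2 * c + 1)) =
      ∑ r ∈ (Finset.range (2 * M)).filter (fun r => p (r / 2)), f r := by
  rw [Finset.sum_filter, Finset.sum_filter, sum_range_two_mul]
  refine Finset.sum_congr rfl fun c _ => ?_
  rw [show 2 * c / 2 = c by omega, show (2 * c + 1) / 2 = c by omega]
  split_ifs <;> simp

/-- The pairs `{2c, 2c + 1}` contained in `T`. -/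
def halve (T : Finset ℕ) : Finset ℕ :=
  (T.image (· / 2)).filter fun c => 2 * c ∈ T ∧ 2 * c + 1 ∈ T

lemma mem_halve {T : Finset ℕ} {c : ℕ} : c ∈ halve T ↔ 2 * c ∈ T ∧ 2 * c + 1 ∈ T := by
  simp only [halve, Finset.mem_filter, Finset.mem_image, and_iff_right_iff_imp]
  exact fun h => ⟨2 * c, h.1, by omega⟩

/-- If the run of pairs stops at `c`, then `T` has a right end at `2c + 1` or `2c + 2`, and `x ↦ (x
- 1) / 2` sends both to `c`. -/
lemma card_rightEnds_halve_le (T : Finset ℕ) : (rightEnds (halve T)).card ≤ (rightEnds T).card := by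
  refine (Finset.card_le_card (t := (rightEnds T).image fun x => (x - 1) / 2) ?_).trans
    Finset.card_image_le
  intro c hc
  simp only [rightEnds, Finset.mem_filter, mem_halve, Finset.mem_image] at hc ⊢
  obtain ⟨⟨h1, h2⟩, h3⟩ := hc
  by_cases h : 2 * c + 2 ∈ T
  · exact ⟨2 * c + 2, ⟨h, fun h' => h3 ⟨h, h'⟩⟩, by omega⟩
  · exact ⟨2 * c + 1, ⟨h2, h⟩, by omega⟩

lemma card_leftEnds_halve_le (T : Finset ℕ) : (leftEnds (halve T)).card ≤ (leftEnds T).card := by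
  refine (Finset.card_le_card (t := (leftEnds T).image fun x => (x + 1) / 2) ?_).trans
    Finset.card_image_le
  intro c hc
  simp only [leftEnds, Finset.mem_filter, mem_halve, Finset.mem_image] at hc ⊢
  obtain ⟨⟨h1, h2⟩, h0, h3⟩ := hc
  rw [show 2 * (c - 1) + 1 = 2 * c - 1 by omega] at h3
  by_cases h : 2 * c - 1 ∈ T
  · refine ⟨2 * c - 1, ⟨h, by omega, fun h' => h3 ⟨?_, h⟩⟩, by omega⟩
    rwa [show 2 * (c - 1) = 2 * c - 1 - 1 by omega]
  · exact ⟨2 * c, ⟨h1, by omega, h⟩, by omega⟩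

/-- The chaining decomposition; scale `i` has blocks of length `2 ^ (j - i)`. Elements of `T` whose
partner is missing are run ends, hence at most `D` in number, and form the finest scale. The
complete pairs form `halve T`, which has no more ends than `T`, so the induction continues. At scale
`0` only `D` blocks exist. -/
lemma sum_le_sum_of_block_sums_le (D : ℕ) (u : ℕ → ℝ) (j : ℕ) :
    ∀ (η : ℕ → ℝ) (T : Finset ℕ), T ⊆ Finset.range (D * 2 ^ j) →
      (leftEnds T).card + (rightEnds T).card ≤ D →
      (∀ i ≤ j, ∀ U ⊆ Finset.range (D * 2 ^ i), U.card ≤ D →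
        ∑ r ∈ (Finset.range (D * 2 ^ j)).filter (fun r => r / 2 ^ (j - i) ∈ U), η r ≤ u i) →
      ∑ r ∈ T, η r ≤ ∑ i ∈ Finset.range (j + 1), u i := by
  induction j with
  | zero =>
    intro η T hT _ h
    have h0 := h 0 le_rfl T hT ((Finset.card_le_card hT).trans (by simp))
    have : (Finset.range (D * 2 ^ 0)).filter (fun r => r / 2 ^ (0 - 0) ∈ T) = T := by
      ext r
      simp only [Finset.mem_filter, Nat.sub_self, pow_zero, Nat.div_one, and_iff_right_iff_imp]
      exact fun h => hT h
    rw [this] at h0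
    simpa using h0
  | succ j ih =>
    intro η T hT hends h
    have hM : D * 2 ^ (j + 1) = 2 * (D * 2 ^ j) := by ring
    have hsub : halve T ⊆ Finset.range (D * 2 ^ j) := by
      intro c hc
      have := Finset.mem_range.1 (hT (mem_halve.1 hc).1)
      rw [hM] at this
      exact Finset.mem_range.2 (by omega)
    have hih := ih (fun c => η (2 * c) + η (2 * c + 1)) (halve T) hsub
      ((add_le_add (card_leftEnds_halve_le T) (card_rightEnds_halve_le T)).trans hends) (by
        intro i hi U hU hUD
        rw [sum_filter_div_two]
        refine (le_of_eq ?_).trans (h i (by omega) U hU hUD)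
        rw [hM]
        refine Finset.sum_congr (Finset.filter_congr fun r _ => ?_) fun _ _ => rfl
        rw [show j + 1 - i = (j - i) + 1 by omega, pow_succ', Nat.div_div_eq_div_mul])
    have hmain : ∑ c ∈ halve T, (η (2 * c) + η (2 * c + 1)) =
        ∑ r ∈ T.filter (fun r => r / 2 ∈ halve T), η r := by
      rw [← Finset.filter_mem_eq_inter.trans (Finset.inter_eq_right.2 hsub), sum_filter_div_two]
      refine Finset.sum_congr ?_ fun _ _ => rfl
      rw [Finset.filter_mem_eq_inter, Finset.inter_eq_right.2 hsub]
      ext r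
      simp only [Finset.mem_filter, Finset.mem_range]
      constructor
      · rintro ⟨-, h2⟩
        refine ⟨?_, h2⟩
        have h2' := mem_halve.1 h2
        rcases Nat.even_or_odd' r with ⟨c, rfl | rfl⟩
        · rw [show 2 * c / 2 = c by omega] at h2'; exact h2'.1
        · rw [show (2 * c + 1) / 2 = c by omega] at h2'; exact h2'.2
      · rintro ⟨h1, h2⟩
        have := Finset.mem_range.1 (hT h1)
        exact ⟨by rwa [← hM], h2⟩
    have hrest : ∑ r ∈ T.filter (fun r => r / 2 ∉ halve T), η r ≤ u (j + 1) := by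
      have h0 := h (j + 1) le_rfl (T.filter (fun r => r / 2 ∉ halve T))
        ((Finset.filter_subset _ _).trans hT) (by
          refine (Finset.card_le_card (t := leftEnds T ∪ rightEnds T) ?_).trans
            ((Finset.card_union_le _ _).trans hends)
          intro r hr
          simp only [Finset.mem_filter, mem_halve, leftEnds, rightEnds, Finset.mem_union] at hr ⊢
          obtain ⟨h1, h2⟩ := hr
          rcases Nat.even_or_odd' r with ⟨c, rfl | rfl⟩
          · rw [show 2 * c / 2 = c by omega] at h2
            exact Or.inr ⟨h1, fun h' => h2 ⟨h1, h'⟩⟩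
          · rw [show (2 * c + 1) / 2 = c by omega] at h2
            exact Or.inl ⟨h1, by omega, fun h' => h2 ⟨h', h1⟩⟩)
      refine (le_of_eq ?_).trans h0
      refine Finset.sum_congr ?_ fun _ _ => rfl
      ext r
      simp only [Finset.mem_filter, Nat.sub_self, pow_zero, Nat.div_one, iff_and_self]
      exact fun h => hT h.1
    rw [Finset.sum_range_succ, ← Finset.sum_filter_add_sum_filter_not T (fun r => r / 2 ∈ halve T),
      ← hmain]
    exact add_le_add hih hrest

/-- The difference of the indicators of `A` at `r` and at `s`. -/
noncomputable def indDiff (A : Set ℕ) (r s : ℕ) : ℝ := A.indicator 1 r - A.indicator 1 s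

lemma indDiff_sq_le (A : Set ℕ) (r s : ℕ) :
    indDiff A r s ^ 2 ≤ A.indicator 1 r + A.indicator 1 s := by
  unfold indDiff
  by_cases h : r ∈ A <;> by_cases h' : s ∈ A <;> simp [h, h']

lemma sum_indicator_le_card {n : ℕ} {f : Fin n → ℕ} (hf : f.Injective) (A : Finset ℕ) :
    ∑ i, (A : Set ℕ).indicator (1 : ℕ → ℝ) (f i) ≤ A.card := by
  have h : ∑ i, (A : Set ℕ).indicator (1 : ℕ → ℝ) (f i) =
      ((Finset.univ.filter fun i => f i ∈ A).card : ℝ) := by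
    simp [Set.indicator_apply]
  rw [h, Nat.cast_le]
  exact Finset.card_le_card_of_injOn f (fun i hi => by simpa using hi) hf.injOn

lemma sum_sgn_eq {n : ℕ} (f g : Fin n → ℕ) (ε : Fin n → Bool) (A : Finset ℕ) :
    ∑ r ∈ A, ∑ i, sgn (ε i) * indDiff {r} (f i) (g i) =
      ∑ i, sgn (ε i) * indDiff A (f i) (g i) := by
  rw [Finset.sum_comm]
  refine Finset.sum_congr rfl fun i _ => ?_
  rw [← Finset.mul_sum]
  congr 1
  simp [indDiff, Set.indicator_apply, Finset.sum_sub_distrib]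

lemma card_filter_div_mem_le (M q : ℕ) (hq : 0 < q) (U : Finset ℕ) :
    ((Finset.range M).filter fun r => r / q ∈ U).card ≤ q * U.card := by
  refine Finset.card_le_mul_card_image_of_maps_to (f := fun r => r / q)
    (fun r hr => (Finset.mem_filter.1 hr).2) q fun b _ => ?_
  refine (Finset.card_le_card (t := Finset.Ico (b * q) (b * q + q)) ?_).trans (by simp)
  intro r hr
  obtain ⟨-, rfl⟩ := Finset.mem_filter.1 hr
  rw [Finset.mem_Ico]
  have h1 := Nat.div_add_mod' r q
  have h2 := Nat.mod_lt r hq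
  omega

/-- Scale `i` gets the threshold `(7 / 8) ^ i * u`; these sum to less than `8 * u`. Since `2 * (7 /
8) ^ 2 > 1`, the drop in variance outweighs the shrinking threshold, and the exponent still grows
fast enough to pay for the `exp (D * (1 + i))` block choices. -/
lemma card_bad_signs_le {n : ℕ} {f g : Fin n → ℕ} (hf : f.Injective) (hg : g.Injective)
    {D j : ℕ} (hD : 0 < D) {t u : ℝ} (ht : 0 ≤ t) (hu : 0 ≤ u)
    (hu2 : 8 * (D * 2 ^ j) * (D + 1 + t) ≤ u ^ 2) :
    (Nat.card {ε : Fin n → Bool // ∃ T ⊆ Finset.range (D * 2 ^ j),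
      (leftEnds T).card + (rightEnds T).card ≤ D ∧
      8 * u < ∑ i, sgn (ε i) * indDiff T (f i) (g i)} : ℝ) ≤ 2 ^ n * Real.exp (-t) := by
  classical
  set G : ℕ → Finset (Finset ℕ) := fun i =>
    (Finset.range (D * 2 ^ i)).powerset.filter fun U => U.card ≤ D
  set B : ℕ → Finset ℕ → Finset ℕ := fun i U =>
    (Finset.range (D * 2 ^ j)).filter fun r => r / 2 ^ (j - i) ∈ U
  set E : ℕ → Finset ℕ → Finset (Fin n → Bool) := fun i U =>
    Finset.univ.filter fun ε => (7 / 8) ^ i * u ≤ ∑ l, sgn (ε l) * indDiff (B i U) (f l) (g l)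
  have hE : ∀ i ≤ j, ∀ U ∈ G i,
      ((E i U).card : ℝ) ≤ 2 ^ n * Real.exp (-((1 + i) * (D + 1 + t))) := by
    intro i hi U hU
    have hB : ((B i U).card : ℝ) ≤ 2 ^ (j - i) * D := by
      have h1 := card_filter_div_mem_le (D * 2 ^ j) (2 ^ (j - i)) (by positivity) U
      have h2 : U.card ≤ D := (Finset.mem_filter.1 hU).2
      exact_mod_cast h1.trans (Nat.mul_le_mul_left _ h2)
    have hv : ∑ l, indDiff (B i U) (f l) (g l) ^ 2 ≤ 2 * (2 ^ (j - i) * D) := by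
      calc ∑ l, indDiff (B i U) (f l) (g l) ^ 2
          ≤ ∑ l, ((B i U : Set ℕ).indicator (1 : ℕ → ℝ) (f l) +
              (B i U : Set ℕ).indicator (1 : ℕ → ℝ) (g l)) :=
            Finset.sum_le_sum fun l _ => indDiff_sq_le _ _ _
        _ ≤ 2 * (2 ^ (j - i) * D) := by
            rw [Finset.sum_add_distrib]
            linarith [sum_indicator_le_card hf (B i U), sum_indicator_le_card hg (B i U)]
    have hD' : (0 : ℝ) < D := by exact_mod_cast hD
    have h := card_rademacher_tail_le _ (u := (7 / 8) ^ i * u) (by positivity) (by positivity) hv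
    rw [Fintype.card_fin] at h
    refine h.trans ?_
    gcongr
    rw [le_div_iff₀ (by positivity)]
    have hpow : (2 : ℝ) ^ j = 2 ^ (j - i) * 2 ^ i := by rw [← pow_add]; congr 1; omega
    -- Bernoulli's inequality for `49 / 32 = 1 + 17 / 32`.
    have hbern : (1 + i : ℝ) ≤ 2 * ((49 / 64) ^ i * 2 ^ i) := by
      rw [← mul_pow]
      have := one_add_mul_le_pow (a := (17 / 32 : ℝ)) (by norm_num) i
      norm_num at this ⊢
      have hi0 : (0 : ℝ) ≤ i := by positivity
      linarith
    have hsq : ((7 / 8 : ℝ) ^ i * u) ^ 2 = (49 / 64) ^ i * u ^ 2 := by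
      rw [mul_pow, ← pow_mul, mul_comm i, pow_mul]; norm_num
    rw [hsq]
    calc (1 + i) * (D + 1 + t) * (2 * (2 * (2 ^ (j - i) * D)))
        ≤ (2 * ((49 / 64) ^ i * 2 ^ i)) * (D + 1 + t) * (2 * (2 * (2 ^ (j - i) * D))) := by gcongr
      _ = (49 / 64) ^ i * (8 * (D * 2 ^ j) * (D + 1 + t)) := by rw [hpow]; ring
      _ ≤ (49 / 64) ^ i * u ^ 2 := by gcongr
  have hsub : {ε : Fin n → Bool | ∃ T ⊆ Finset.range (D * 2 ^ j),
      (leftEnds T).card + (rightEnds T).card ≤ D ∧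
      8 * u < ∑ i, sgn (ε i) * indDiff T (f i) (g i)} ⊆
      ((Finset.range (j + 1)).biUnion fun i => (G i).biUnion (E i) : Finset _) := by
    rintro ε ⟨T, hT, hends, hlt⟩
    by_contra hcon
    refine hlt.not_ge ?_
    have h := sum_le_sum_of_block_sums_le D (fun i => (7 / 8) ^ i * u) j
      (fun r => ∑ i, sgn (ε i) * indDiff {r} (f i) (g i)) T hT hends (by
        intro i hi U hU hUD
        rw [sum_sgn_eq]
        by_contra hlt'
        refine hcon ?_
        simp only [Finset.coe_biUnion, Set.mem_iUnion, Finset.mem_coe]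
        exact ⟨i, Finset.mem_range.2 (by omega), U,
          Finset.mem_filter.2 ⟨Finset.mem_powerset.2 hU, hUD⟩,
          Finset.mem_filter.2 ⟨Finset.mem_univ _, (not_le.1 hlt').le⟩⟩)
    rw [sum_sgn_eq] at h
    refine h.trans ?_
    rw [← Finset.sum_mul]
    gcongr
    rw [geom_sum_eq (by norm_num), div_le_iff_of_neg (by norm_num)]
    have : (0 : ℝ) ≤ (7 / 8) ^ (j + 1) := by positivity
    linarith
  have hcard : Nat.card {ε : Fin n → Bool // ∃ T ⊆ Finset.range (D * 2 ^ j),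
      (leftEnds T).card + (rightEnds T).card ≤ D ∧
      8 * u < ∑ i, sgn (ε i) * indDiff T (f i) (g i)} ≤
      ∑ i ∈ Finset.range (j + 1), ∑ U ∈ G i, (E i U).card := by
    refine (Nat.card_mono (Finset.finite_toSet _) hsub).trans ?_
    rw [Nat.card_coe_set_eq, Set.ncard_coe_finset]
    exact Finset.card_biUnion_le.trans (Finset.sum_le_sum fun i _ => Finset.card_biUnion_le)
  calc (Nat.card _ : ℝ) ≤ ∑ i ∈ Finset.range (j + 1), ∑ U ∈ G i, ((E i U).card : ℝ) := by
        exact_mod_cast hcard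
    _ ≤ ∑ i ∈ Finset.range (j + 1), 2 ^ n * Real.exp (-t) * (1 / 2 / 2 ^ i) := by
        refine Finset.sum_le_sum fun i hi => ?_
        have hi' : i ≤ j := Nat.lt_succ_iff.1 (Finset.mem_range.1 hi)
        calc ∑ U ∈ G i, ((E i U).card : ℝ)
            ≤ (G i).card • (2 ^ n * Real.exp (-((1 + i) * (D + 1 + t)))) :=
              Finset.sum_le_card_nsmul _ _ _ (hE i hi')
          _ ≤ Real.exp (D * (1 + i)) * (2 ^ n * Real.exp (-((1 + i) * (D + 1 + t)))) := by
              rw [nsmul_eq_mul]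
              gcongr
              exact card_subsets_card_le D i
          _ = 2 ^ n * Real.exp (-((1 + i) * (1 + t))) := by
              rw [mul_left_comm, ← Real.exp_add]; congr 2; ring
          _ ≤ 2 ^ n * (Real.exp (-t) * Real.exp (-((i + 1 : ℕ) : ℝ))) := by
              rw [← Real.exp_add]
              gcongr
              push_cast
              have : 0 ≤ (i : ℝ) * t := by positivity
              linarith
          _ ≤ 2 ^ n * Real.exp (-t) * (1 / 2 / 2 ^ i) := by
              rw [mul_assoc]
              gcongr
              have h2e : (2 : ℝ) ≤ Real.exp 1 := by
                have := Real.add_one_le_exp (1 : ℝ); linarith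
              rw [Real.exp_neg, div_div, ← pow_succ', one_div]
              apply inv_anti₀ (by positivity)
              calc (2 : ℝ) ^ (i + 1) ≤ Real.exp 1 ^ (i + 1) := by gcongr
                _ = Real.exp (i + 1 : ℕ) := by rw [← Real.exp_nat_mul, mul_one]
    _ ≤ 2 ^ n * Real.exp (-t) := by
        rw [← Finset.mul_sum]
        refine mul_le_of_le_one_right (by positivity) ?_
        have : ∑ i ∈ Finset.range (j + 1), (1 / 2 / 2 ^ i : ℝ) =
            1 / 2 * ∑ i ∈ Finset.range (j + 1), (1 / 2 : ℝ) ^ i := by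
          rw [Finset.mul_sum]
          exact Finset.sum_congr rfl fun i _ => by rw [one_div_pow]; ring
        have h0 : (0 : ℝ) ≤ (1 / 2) ^ (j + 1) := by positivity
        have h1 : ∑ i ∈ Finset.range (j + 1), (1 / 2 : ℝ) ^ i ≤ 2 := by
          rw [geom_sum_eq (by norm_num), div_le_iff_of_neg (by norm_num)]
          linarith
        linarith

/-! ### Patterns cut out by unions of intervals -/

/-- A piece `p j` contains at most one right end: for `a < b` in `p j`, the number `a + 1` lies
between them and so in `T`. Left ends are symmetric. -/
lemma card_ends_le {k : ℕ} {T : Finset ℕ} (p : Fin k → Set ℕ) (hT : ∀ r ∈ T, ∃ j, r ∈ p j)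
    (hp : ∀ j r r' s, r ∈ p j → r' ∈ p j → r ≤ s → s ≤ r' → s ∈ T) :
    (leftEnds T).card + (rightEnds T).card ≤ 2 * k := by
  classical
  have hr : (rightEnds T).card ≤ (Finset.univ : Finset (Fin k)).card := by
    refine Finset.card_le_card_of_forall_subsingleton (fun r j => r ∈ p j)
      (fun r hr => ?_) fun j _ => ?_
    · obtain ⟨j, hj⟩ := hT r (Finset.mem_filter.1 hr).1
      exact ⟨j, Finset.mem_univ _, hj⟩
    · have key : ∀ a b, a ∈ rightEnds T → a ∈ p j → b ∈ p j → ¬ a < b := fun a b ha haj hbj hab =>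
        (Finset.mem_filter.1 ha).2 (hp j a b (a + 1) haj hbj (by omega) (by omega))
      rintro a ⟨ha, haj⟩ b ⟨hb, hbj⟩
      exact le_antisymm (not_lt.1 (key b a hb hbj haj)) (not_lt.1 (key a b ha haj hbj))
  have hl : (leftEnds T).card ≤ (Finset.univ : Finset (Fin k)).card := by
    refine Finset.card_le_card_of_forall_subsingleton (fun r j => r ∈ p j)
      (fun r hr => ?_) fun j _ => ?_
    · obtain ⟨j, hj⟩ := hT r (Finset.mem_filter.1 hr).1
      exact ⟨j, Finset.mem_univ _, hj⟩
    · have key : ∀ a b, b ∈ leftEnds T → a ∈ p j → b ∈ p j → ¬ a < b := fun a b hb haj hbj hab =>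
        (Finset.mem_filter.1 hb).2.2 (hp j a b (b - 1) haj hbj (by omega) (by omega))
      rintro a ⟨ha, haj⟩ b ⟨hb, hbj⟩
      exact le_antisymm (not_lt.1 (key b a ha hbj haj)) (not_lt.1 (key a b hb haj hbj))
  rw [Finset.card_univ, Fintype.card_fin] at hl hr
  omega

/-- The ranks of the points of `y` that lie in `C`. -/
noncomputable def ranksIn {N : ℕ} (y : Fin N → ℝ) (C : Set ℝ) : Finset ℕ := by
  classical
  exact (Finset.univ.filter fun r => y (Tuple.sort y r) ∈ C).map Fin.valEmbedding

lemma mem_ranksIn {N : ℕ} {y : Fin N → ℝ} {C : Set ℝ} {r : Fin N} :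
    (r : ℕ) ∈ ranksIn y C ↔ y (Tuple.sort y r) ∈ C := by
  simp [ranksIn, Fin.val_inj]

lemma exists_of_mem_ranksIn {N : ℕ} {y : Fin N → ℝ} {C : Set ℝ} {r : ℕ} (h : r ∈ ranksIn y C) :
    ∃ r' : Fin N, (r' : ℕ) = r ∧ y (Tuple.sort y r') ∈ C := by
  simp only [ranksIn, Finset.mem_map, Finset.mem_filter, Finset.mem_univ, true_and,
    Fin.valEmbedding_apply] at h
  obtain ⟨r', h1, h2⟩ := h
  exact ⟨r', h2, h1⟩

lemma card_ends_ranksIn_le {N k : ℕ} (y : Fin N → ℝ) {C : Set ℝ} (hC : C ∈ unionsOfIntervals k) :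
    (leftEnds (ranksIn y C)).card + (rightEnds (ranksIn y C)).card ≤ 2 * k := by
  obtain ⟨I, hI, rfl⟩ := hC
  refine card_ends_le (fun j => {r | r ∈ ranksIn y (I j)}) (fun r hr => ?_) ?_
  · obtain ⟨r', rfl, h⟩ := exists_of_mem_ranksIn hr
    obtain ⟨j, hj⟩ := Set.mem_iUnion.1 h
    exact ⟨j, mem_ranksIn.2 hj⟩
  · intro j a b s ha hb has hsb
    obtain ⟨a', rfl, ha'⟩ := exists_of_mem_ranksIn ha
    obtain ⟨b', rfl, hb'⟩ := exists_of_mem_ranksIn hb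
    lift s to Fin N using hsb.trans_lt b'.2
    exact mem_ranksIn.2 (Set.mem_iUnion.2 ⟨j, (hI j).out ha' hb'
      ⟨Tuple.monotone_sort y has, Tuple.monotone_sort y hsb⟩⟩)

/-- The number of points of `C` in the first half of `y` minus that in the second half. -/
noncomputable def discrepancy {n : ℕ} (y : Fin (2 * n + 1) → ℝ) (C : Set ℝ) : ℝ :=
  ∑ i, (C.indicator 1 (firstHalf y i) - C.indicator 1 (secondHalf y i))

/-- The samples for which some union of `k` intervals has discrepancy more than `w`. -/
def badSamples (n k : ℕ) (w : ℝ) : Set (Fin (2 * n + 1) → ℝ) :=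
  {y | ∃ C ∈ unionsOfIntervals k, w < discrepancy y C}

/-- The map on the indices that exchanges `i` and `n + i` whenever `ε i` is `true`. -/
def swapIndex {n : ℕ} (ε : Fin n → Bool) (l : Fin (2 * n + 1)) : Fin (2 * n + 1) :=
  if h : (l : ℕ) < n then (if ε ⟨l, h⟩ then ⟨n + l, by omega⟩ else l)
  else if h' : (l : ℕ) < 2 * n then (if ε ⟨l - n, by omega⟩ then ⟨l - n, by omega⟩ else l)
  else l

lemma swapIndex_swapIndex {n : ℕ} (ε : Fin n → Bool) (l : Fin (2 * n + 1)) :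
    swapIndex ε (swapIndex ε l) = l := by
  by_cases h : (l : ℕ) < n
  · by_cases hε : ε ⟨l, h⟩
    · have h2 : n + (l : ℕ) < 2 * n := by omega
      simp [swapIndex, h, hε, h2]
    · simp [swapIndex, h, hε]
  · by_cases h' : (l : ℕ) < 2 * n
    · have h2 : (l : ℕ) - n < n := by omega
      have h3 : n + ((l : ℕ) - n) = l := by omega
      by_cases hε : ε ⟨l - n, h2⟩
      · simp [swapIndex, h, h', h2, hε, h3]
      · simp [swapIndex, h, h', hε]
    · simp [swapIndex, h, h']

/-- `swapIndex` as a permutation. -/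
def swapPerm {n : ℕ} (ε : Fin n → Bool) : Equiv.Perm (Fin (2 * n + 1)) where
  toFun := swapIndex ε
  invFun := swapIndex ε
  left_inv := swapIndex_swapIndex ε
  right_inv := swapIndex_swapIndex ε

lemma firstHalf_swapPerm {n : ℕ} (ε : Fin n → Bool) (y : Fin (2 * n + 1) → ℝ) (i : Fin n) :
    firstHalf (y ∘ swapPerm ε) i = if ε i then secondHalf y i else firstHalf y i := by
  have h : swapPerm ε ⟨i, by omega⟩ = if ε i then ⟨n + i, by omega⟩ else ⟨i, by omega⟩ := by
    simp [swapPerm, swapIndex]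
  simp only [firstHalf, secondHalf, Function.comp_apply, h]
  split_ifs <;> rfl

lemma secondHalf_swapPerm {n : ℕ} (ε : Fin n → Bool) (y : Fin (2 * n + 1) → ℝ) (i : Fin n) :
    secondHalf (y ∘ swapPerm ε) i = if ε i then firstHalf y i else secondHalf y i := by
  have h : swapPerm ε ⟨n + i, by omega⟩ = if ε i then ⟨i, by omega⟩ else ⟨n + i, by omega⟩ := by
    have h2 : n + (i : ℕ) < 2 * n := by omega
    simp [swapPerm, swapIndex, h2]
  simp only [firstHalf, secondHalf, Function.comp_apply, h]
  split_ifs <;> rfl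

lemma discrepancy_swapPerm {n : ℕ} (ε : Fin n → Bool) (y : Fin (2 * n + 1) → ℝ) (C : Set ℝ) :
    discrepancy (y ∘ swapPerm ε) C =
      ∑ i, sgn (ε i) * (C.indicator 1 (firstHalf y i) - C.indicator 1 (secondHalf y i)) := by
  refine Finset.sum_congr rfl fun i _ => ?_
  rw [firstHalf_swapPerm, secondHalf_swapPerm]
  by_cases h : ε i <;> simp [h, sgn]

/-- For a fixed sample, points are replaced by their ranks. The last observation occupies a rank but
carries no sign, whence `2 * n + 1` in `hn`. -/
lemma card_bad_swaps_le {n k : ℕ} (y : Fin (2 * n + 1) → ℝ) {D j : ℕ} (hD : 0 < D)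
    (hk : 2 * k ≤ D) (hn : 2 * n + 1 ≤ D * 2 ^ j) {t u : ℝ} (ht : 0 ≤ t) (hu : 0 ≤ u)
    (hu2 : 8 * (D * 2 ^ j) * (D + 1 + t) ≤ u ^ 2) :
    (Nat.card {ε : Fin n → Bool // y ∘ swapPerm ε ∈ badSamples n k (8 * u)} : ℝ) ≤
      2 ^ n * Real.exp (-t) := by
  set f : Fin n → ℕ := fun i => (Tuple.sort y).symm ⟨i, by omega⟩
  set g : Fin n → ℕ := fun i => (Tuple.sort y).symm ⟨n + i, by omega⟩
  have hf : f.Injective := by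
    intro a b hab
    have := (Tuple.sort y).symm.injective (Fin.ext hab)
    simpa [Fin.ext_iff] using this
  have hg : g.Injective := by
    intro a b hab
    have := (Tuple.sort y).symm.injective (Fin.ext hab)
    simpa [Fin.ext_iff] using this
  refine le_trans ?_ (card_bad_signs_le hf hg hD ht hu hu2)
  rw [Nat.cast_le]
  refine Nat.card_mono (Set.toFinite _) ?_
  rintro ε ⟨C, hC, hlt⟩
  refine ⟨ranksIn y C, fun r hr => ?_, (card_ends_ranksIn_le y hC).trans hk, ?_⟩
  · obtain ⟨r', rfl, -⟩ := exists_of_mem_ranksIn hr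
    exact Finset.mem_range.2 (r'.2.trans_le hn)
  · rw [discrepancy_swapPerm] at hlt
    refine hlt.trans_eq (Finset.sum_congr rfl fun i _ => ?_)
    have key : ∀ l : Fin (2 * n + 1), C.indicator (1 : ℝ → ℝ) (y l) =
        (ranksIn y C : Set ℕ).indicator 1 ((Tuple.sort y).symm l : ℕ) := by
      intro l
      have : (((Tuple.sort y).symm l : Fin _) : ℕ) ∈ ranksIn y C ↔ y l ∈ C := by
        rw [mem_ranksIn, Equiv.apply_symm_apply]
      by_cases h : y l ∈ C <;> simp [this, h]
    simp only [indDiff, firstHalf, secondHalf, key, f, g]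

/-! ### Measurability and probability of the bad samples -/

/-- The relative order of the entries of `y`. -/
def orderPattern {N : ℕ} (y : Fin N → ℝ) : Fin N → Fin N → Prop := fun a b => y a ≤ y b

lemma measurable_orderPattern {N : ℕ} : Measurable (orderPattern (N := N)) :=
  measurable_pi_iff.2 fun a => measurable_pi_iff.2 fun b =>
    measurable_to_prop (by
      have : MeasurableSet {y : Fin N → ℝ | y a ≤ y b} :=
        measurableSet_le (measurable_pi_apply a) (measurable_pi_apply b)
      convert this using 1
      ext y
      simp [orderPattern])

/-- Each interval is replaced by the order hull of the points of `y'` whose partners in `y` it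
contains. -/
lemma exists_transport {N k : ℕ} {y y' : Fin N → ℝ} (h : orderPattern y = orderPattern y')
    {C : Set ℝ} (hC : C ∈ unionsOfIntervals k) :
    ∃ C' ∈ unionsOfIntervals k, ∀ i, y' i ∈ C' ↔ y i ∈ C := by
  have hle : ∀ a b, y a ≤ y b ↔ y' a ≤ y' b := fun a b => iff_of_eq (congrFun (congrFun h a) b)
  obtain ⟨I, hI, rfl⟩ := hC
  refine ⟨_, ⟨fun l => {x | ∃ a b, y a ∈ I l ∧ y b ∈ I l ∧ y' a ≤ x ∧ x ≤ y' b},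
    fun l => ⟨?_⟩, rfl⟩, fun i => ?_⟩
  · rintro x ⟨a, -, ha, -, hax, -⟩ z ⟨-, b, -, hb, -, hzb⟩ w ⟨hxw, hwz⟩
    exact ⟨a, b, ha, hb, hax.trans hxw, hwz.trans hzb⟩
  · simp only [Set.mem_iUnion, Set.mem_ofPred_eq]
    refine exists_congr fun l => ⟨?_, fun h => ⟨i, i, h, h, le_rfl, le_rfl⟩⟩
    rintro ⟨a, b, ha, hb, hai, hib⟩
    exact (hI l).out ha hb ⟨(hle _ _).2 hai, (hle _ _).2 hib⟩

/-- The quantifier over `C` is uncountable, but membership depends only on the order pattern of the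
sample, which takes finitely many values. -/
lemma measurableSet_badSamples (n k : ℕ) (w : ℝ) : MeasurableSet (badSamples n k w) := by
  have : badSamples n k w = orderPattern ⁻¹' (orderPattern '' badSamples n k w) := by
    refine (Set.subset_preimage_image _ _).antisymm ?_
    rintro y' ⟨y, ⟨C, hC, hlt⟩, h⟩
    obtain ⟨C', hC', hmem⟩ := exists_transport h hC
    refine ⟨C', hC', hlt.trans_eq (Finset.sum_congr rfl fun i _ => ?_)⟩
    have key : ∀ l, C.indicator (1 : ℝ → ℝ) (y l) = C'.indicator 1 (y' l) := fun l => by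
      by_cases hl : y l ∈ C <;> simp [hmem, hl]
    simp only [firstHalf, secondHalf, key]
  rw [this]
  exact measurable_orderPattern (Set.toFinite _).measurableSet

lemma measurePreserving_comp_perm {N : ℕ} (P : Measure ℝ) [IsProbabilityMeasure P]
    (σ : Equiv.Perm (Fin N)) :
    MeasurePreserving (fun y : Fin N → ℝ => y ∘ σ) (Measure.pi fun _ => P)
      (Measure.pi fun _ => P) := by
  have h := measurePreserving_piCongrLeft (fun _ : Fin N => P) σ.symm
  convert h using 1
  ext y i
  simp [MeasurableEquiv.piCongrLeft, Equiv.piCongrLeft_apply]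

/-- Every swap preserves the product measure, so the probability equals its average over all `2 ^ n`
swaps, and the count of bad swaps bounds the integrand pointwise. -/
lemma measure_badSamples_le {n k : ℕ} (P : Measure ℝ) [IsProbabilityMeasure P] {D j : ℕ}
    (hD : 0 < D) (hk : 2 * k ≤ D) (hn : 2 * n + 1 ≤ D * 2 ^ j) {t u : ℝ} (ht : 0 ≤ t) (hu : 0 ≤ u)
    (hu2 : 8 * (D * 2 ^ j) * (D + 1 + t) ≤ u ^ 2) :
    (Measure.pi fun _ => P) (badSamples n k (8 * u)) ≤ ENNReal.ofReal (Real.exp (-t)) := by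
  classical
  set ν : Measure (Fin (2 * n + 1) → ℝ) := Measure.pi fun _ => P
  set B := badSamples n k (8 * u)
  have hB : MeasurableSet B := measurableSet_badSamples _ _ _
  have hmp := fun ε : Fin n → Bool => measurePreserving_comp_perm P (swapPerm ε)
  have h1 : (2 ^ n : ENNReal) * ν B =
      ∫⁻ y, ∑ ε : Fin n → Bool, B.indicator 1 (y ∘ swapPerm ε) ∂ν := by
    rw [lintegral_finsetSum]
    · have : ∀ ε : Fin n → Bool, ∫⁻ y, B.indicator 1 (y ∘ swapPerm ε) ∂ν = ν B := by
        intro ε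
        rw [(hmp ε).lintegral_comp (measurable_one.indicator hB), lintegral_indicator_one hB]
      simp [this]
    · exact fun ε _ => (measurable_one.indicator hB).comp (hmp ε).measurable
  have h2 : ∀ y : Fin (2 * n + 1) → ℝ, ∑ ε : Fin n → Bool, B.indicator 1 (y ∘ swapPerm ε) ≤
      (2 ^ n : ENNReal) * ENNReal.ofReal (Real.exp (-t)) := by
    intro y
    have h3 := card_bad_swaps_le (k := k) y hD hk hn ht hu hu2
    have h4 : ∑ ε : Fin n → Bool, B.indicator (1 : (Fin (2 * n + 1) → ℝ) → ENNReal) (y ∘ swapPerm ε) =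
        ENNReal.ofReal (Nat.card {ε : Fin n → Bool // y ∘ swapPerm ε ∈ B}) := by
      rw [ENNReal.ofReal_natCast, Nat.card_eq_fintype_card, Fintype.card_subtype]
      simp [Set.indicator_apply]
    rw [h4]
    refine (ENNReal.ofReal_le_ofReal h3).trans_eq ?_
    rw [ENNReal.ofReal_mul (by positivity), ENNReal.ofReal_pow (by norm_num)]
    simp
  have h5 : (2 ^ n : ENNReal) * ν B ≤ 2 ^ n * ENNReal.ofReal (Real.exp (-t)) := by
    rw [h1]
    refine (lintegral_mono h2).trans_eq ?_
    simp [ν]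
  exact (ENNReal.mul_le_mul_iff_right (by simp) (by simp)).1 h5

/-! ### Order statistics -/

lemma card_le_lt_of_lt_orderStat {n : ℕ} {v : Fin n → ℕ} {r x : ℕ} (h : x < orderStat v r) :
    (Finset.univ.filter fun i => v i ≤ x).card < r := by
  unfold orderStat at h
  split_ifs at h with hr
  · have hsub : (Finset.univ.filter fun i => v i ≤ x) ⊆
        (Finset.Iio (⟨r - 1, by omega⟩ : Fin n)).image (Tuple.sort v) := by
      intro i hi
      refine Finset.mem_image.2 ⟨(Tuple.sort v).symm i, Finset.mem_Iio.2 ?_, by simp⟩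
      by_contra hcon
      have := Tuple.monotone_sort v (not_lt.1 hcon)
      simp only [Function.comp_apply, Equiv.apply_symm_apply] at this
      have := (Finset.mem_filter.1 hi).2
      omega
    have := (Finset.card_le_card hsub).trans Finset.card_image_le
    rw [Fin.card_Iio] at this
    simp only at this
    omega
  · exact absurd h (Nat.not_lt_zero _)

lemma le_card_le_orderStat {n : ℕ} (v : Fin n → ℕ) {r : ℕ} (hr : r ≤ n) :
    r ≤ (Finset.univ.filter fun i => v i ≤ orderStat v r).card := by
  rcases Nat.eq_zero_or_pos r with rfl | h0
  · exact Nat.zero_le _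
  have hsub : (Finset.Iic (⟨r - 1, by omega⟩ : Fin n)).image (Tuple.sort v) ⊆
      Finset.univ.filter fun i => v i ≤ orderStat v r := by
    intro i hi
    obtain ⟨p, hp, rfl⟩ := Finset.mem_image.1 hi
    refine Finset.mem_filter.2 ⟨Finset.mem_univ _, ?_⟩
    rw [orderStat, dif_pos ⟨h0, hr⟩]
    exact Tuple.monotone_sort v (Finset.mem_Iic.1 hp)
  have := Finset.card_le_card hsub
  rw [Finset.card_image_of_injective _ (Tuple.sort v).injective, Fin.card_Iic] at this
  simp only at this
  omega

/-! ### Scores and the prediction set -/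

lemma score_lt_score {m : ℕ} {S : Fin m → Set ℝ} (hS : Monotone S) {j : Fin m} {x z : ℝ}
    (hx : x ∉ S j) (hz : z ∈ S j) : score S x < score S z := by
  classical
  have hle : ∀ l, (S l).indicator (fun _ => (1 : ℕ)) x ≤ (S l).indicator (fun _ => 1) z := by
    intro l
    by_cases hl : x ∈ S l
    · have : z ∈ S l := by
        rcases le_total l j with h | h
        · exact absurd (hS h hl) hx
        · exact hS h hz
      simp [hl, this]
    · simp [hl]
  exact Finset.sum_lt_sum (fun l _ => hle l) ⟨j, Finset.mem_univ _, by simp [hx, hz]⟩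

/-- A point outside `S j` scores strictly below every calibration point in `S j`. Were it in the
prediction set, the calibration points scoring at most the threshold would all lie outside `S j`,
where too few remain. -/
lemma predictionSet_subset {n m : ℕ} {α : ℝ} {S : Fin m → Set ℝ} (hS : Monotone S)
    {z : Fin n → ℝ} (j : Fin m) (hr : ⌊((n : ℝ) + 1) * α⌋₊ ≤ n)
    (hj : (n : ℝ) < ∑ i, (S j).indicator 1 (z i) + ⌊((n : ℝ) + 1) * α⌋₊) :
    predictionSet α S z ⊆ S j := by
  classical
  intro x hx
  by_contra hxj
  have h1 := le_card_le_orderStat (fun i => score S (z i)) hr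
  have h2 : (Finset.univ.filter fun i => score S (z i) ≤
      orderStat (fun i => score S (z i)) ⌊((n : ℝ) + 1) * α⌋₊) ⊆
      Finset.univ.filter fun i => ¬ z i ∈ S j := by
    intro i hi
    refine Finset.mem_filter.2 ⟨Finset.mem_univ _, fun hij => ?_⟩
    exact (score_lt_score hS hxj hij).not_ge ((Finset.mem_filter.1 hi).2.trans hx)
  have h3 := h1.trans (Finset.card_le_card h2)
  have h4 := Finset.card_filter_add_card_filter_not (s := Finset.univ) (fun i => z i ∈ S j)
  rw [Finset.card_univ, Fintype.card_fin] at h4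
  have h5 : ∑ i, (S j).indicator (1 : ℝ → ℝ) (z i) =
      ((Finset.univ.filter fun i => z i ∈ S j).card : ℝ) := by
    simp [Set.indicator_apply]
  rw [h5] at hj
  have h6 : n < (Finset.univ.filter fun i => z i ∈ S j).card + ⌊((n : ℝ) + 1) * α⌋₊ := by
    exact_mod_cast hj
  omega

lemma empirical_real_eq {n : ℕ} (y : Fin n → ℝ) (C : Set ℝ) :
    (empirical y).real C = (∑ i, C.indicator 1 (y i)) / n := by
  have h : ∀ i, ((Measure.dirac (y i)) C).toReal = C.indicator 1 (y i) := by
    intro i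
    by_cases hi : y i ∈ C <;> simp [Measure.dirac_apply, hi]
  rw [empirical, Measure.real, Measure.smul_apply, Measure.finsetSum_apply, smul_eq_mul,
    ENNReal.toReal_mul, ENNReal.toReal_sum (fun i _ => measure_ne_top _ _)]
  simp only [h, ENNReal.toReal_inv, ENNReal.toReal_natCast]
  rw [div_eq_inv_mul]

/-! ### Coverage -/

/-- All low-rank indices are counted by the one among them with the largest value. Ties do no harm.
-/
lemma card_low_rank_le {ι : Type*} [Fintype ι] (W : ι → ℕ) (r : ℕ) :
    (Finset.univ.filter fun i => (Finset.univ.filter fun j => W j ≤ W i).card ≤ r).card ≤ r := by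
  classical
  set F := Finset.univ.filter fun i => (Finset.univ.filter fun j => W j ≤ W i).card ≤ r
  rcases F.eq_empty_or_nonempty with h | h
  · simp [h]
  · obtain ⟨i, hi, hmax⟩ := Finset.exists_max_image F W h
    exact (Finset.card_le_card fun j hj =>
      Finset.mem_filter.2 ⟨Finset.mem_univ _, hmax j hj⟩).trans (Finset.mem_filter.1 hi).2

/-- The score of the observation number `n + i + 1`. -/
noncomputable def laterScore {n m : ℕ} (S : Fin m → (Fin n → ℝ) → Set ℝ)
    (y : Fin (2 * n + 1) → ℝ) (i : Fin (n + 1)) : ℕ :=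
  score (fun j => S j (firstHalf y)) (y ⟨n + i, by omega⟩)

/-- The samples for which at most `r` of the later scores are at most the one with index `i`. -/
def lowRank {n m : ℕ} (S : Fin m → (Fin n → ℝ) → Set ℝ) (r : ℕ) (i : Fin (n + 1)) :
    Set (Fin (2 * n + 1) → ℝ) :=
  {y | (Finset.univ.filter fun j => laterScore S y j ≤ laterScore S y i).card ≤ r}

lemma mem_lowRank_of_notMem {n m : ℕ} {α : ℝ} {S : Fin m → (Fin n → ℝ) → Set ℝ}
    {y : Fin (2 * n + 1) → ℝ} (h : y (Fin.last (2 * n)) ∉ splitConformalSet α S y) :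
    y ∈ lowRank S ⌊((n : ℝ) + 1) * α⌋₊ (Fin.last n) := by
  have hlast : (⟨n + (Fin.last n : Fin (n + 1)), by simp; omega⟩ : Fin (2 * n + 1)) =
      Fin.last (2 * n) := by
    ext; simp; omega
  have h1 := card_le_lt_of_lt_orderStat (not_le.1 h)
  change Finset.card _ ≤ _
  rw [Finset.card_filter] at h1 ⊢
  rw [Fin.sum_univ_castSucc, if_pos le_rfl]
  have h2 : ∀ i : Fin n, laterScore S y i.castSucc =
      score (fun j => S j (firstHalf y)) (secondHalf y i) := fun i => rfl
  have h3 : laterScore S y (Fin.last n) =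
      score (fun j => S j (firstHalf y)) (y (Fin.last (2 * n))) := by
    rw [laterScore, hlast]
  simp only [h2, h3]
  exact h1

lemma measurable_laterScore {n m : ℕ} {S : Fin m → (Fin n → ℝ) → Set ℝ}
    (hS : ∀ j, MeasurableSet {p : (Fin n → ℝ) × ℝ | p.2 ∈ S j p.1}) (i : Fin (n + 1)) :
    Measurable fun y => laterScore S y i := by
  unfold laterScore score
  refine Finset.measurable_fun_sum _ fun j _ => ?_
  have hg : Measurable fun y : Fin (2 * n + 1) → ℝ =>
      ((firstHalf y, y ⟨n + i, by omega⟩) : (Fin n → ℝ) × ℝ) :=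
    (measurable_pi_iff.2 fun l => measurable_pi_apply _).prodMk (measurable_pi_apply _)
  exact (measurable_const : Measurable fun _ : Fin (2 * n + 1) → ℝ => (1 : ℕ)).indicator
    (hg (hS j))

lemma measurableSet_lowRank {n m : ℕ} {S : Fin m → (Fin n → ℝ) → Set ℝ}
    (hS : ∀ j, MeasurableSet {p : (Fin n → ℝ) × ℝ | p.2 ∈ S j p.1}) (r : ℕ) (i : Fin (n + 1)) :
    MeasurableSet (lowRank S r i) := by
  have h : Measurable fun y =>
      (Finset.univ.filter fun j => laterScore S y j ≤ laterScore S y i).card := by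
    simp only [Finset.card_filter]
    exact Finset.measurable_fun_sum _ fun j _ => Measurable.ite
      (measurableSet_le (measurable_laterScore hS j) (measurable_laterScore hS i))
      measurable_const measurable_const
  exact h measurableSet_Iic

/-- Exchanging two later observations leaves the first half, and hence the score function,
unchanged. -/
lemma measure_lowRank_eq {n m : ℕ} (P : Measure ℝ) [IsProbabilityMeasure P]
    {S : Fin m → (Fin n → ℝ) → Set ℝ}
    (hS : ∀ j, MeasurableSet {p : (Fin n → ℝ) × ℝ | p.2 ∈ S j p.1}) (r : ℕ) (i i' : Fin (n + 1)) :
    (Measure.pi fun _ => P) (lowRank S r i) = (Measure.pi fun _ => P) (lowRank S r i') := by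
  set c : Fin (n + 1) → Fin (2 * n + 1) := fun i => ⟨n + i, by omega⟩
  have hcinj : c.Injective := fun a b h => by simpa [c, Fin.ext_iff] using h
  set σ := Equiv.swap (c i) (c i')
  have hmp := measurePreserving_comp_perm P σ
  rw [← hmp.measure_preimage (measurableSet_lowRank hS r i').nullMeasurableSet]
  congr 1
  ext y
  have hfirst : firstHalf (y ∘ σ) = firstHalf y := by
    ext l
    have : σ ⟨l, by omega⟩ = ⟨l, by omega⟩ :=
      Equiv.swap_apply_of_ne_of_ne (by simp [c, Fin.ext_iff]; omega) (by simp [c, Fin.ext_iff]; omega)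
    simp [firstHalf, this]
  have hlater : ∀ j, laterScore S (y ∘ σ) j = laterScore S y (Equiv.swap i i' j) := by
    intro j
    have : σ (c j) = c (Equiv.swap i i' j) := by
      simp only [σ, Equiv.swap_apply_def, hcinj.eq_iff]
      split_ifs <;> rfl
    simp only [laterScore, hfirst, Function.comp_apply]
    exact congrArg _ (congrArg y this)
  simp only [lowRank, Set.mem_preimage, Set.mem_ofPred_eq, hlater, Equiv.swap_apply_right]
  have hcard : (Finset.univ.filter fun j =>
      laterScore S y (Equiv.swap i i' j) ≤ laterScore S y i).card =
      (Finset.univ.filter fun j => laterScore S y j ≤ laterScore S y i).card :=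
    Finset.card_equiv (Equiv.swap i i') (by simp)
  rw [hcard]

lemma measure_lowRank_le {n m : ℕ} (P : Measure ℝ) [IsProbabilityMeasure P]
    {S : Fin m → (Fin n → ℝ) → Set ℝ}
    (hS : ∀ j, MeasurableSet {p : (Fin n → ℝ) × ℝ | p.2 ∈ S j p.1}) (r : ℕ) (i : Fin (n + 1)) :
    ((n : ENNReal) + 1) * (Measure.pi fun _ => P) (lowRank S r i) ≤ r := by
  classical
  set ν : Measure (Fin (2 * n + 1) → ℝ) := Measure.pi fun _ => P
  have h1 : ((n : ENNReal) + 1) * ν (lowRank S r i) =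
      ∫⁻ y, ∑ i', (lowRank S r i').indicator 1 y ∂ν := by
    rw [lintegral_finsetSum _ fun i' _ => measurable_one.indicator (measurableSet_lowRank hS r i')]
    simp only [lintegral_indicator_one (measurableSet_lowRank hS r _)]
    rw [Finset.sum_congr rfl fun i' _ => measure_lowRank_eq P hS r i' i]
    simp [ν]
  have h2 : ∀ y, ∑ i', (lowRank S r i').indicator (1 : (Fin (2 * n + 1) → ℝ) → ENNReal) y ≤ (r : ENNReal) := by
    intro y
    have h3 := card_low_rank_le (laterScore S y) r
    have h4 : ∑ i', (lowRank S r i').indicator (1 : (Fin (2 * n + 1) → ℝ) → ENNReal) y =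
        ((Finset.univ.filter fun i' => y ∈ lowRank S r i').card : ENNReal) := by
      simp [Set.indicator_apply]
    rw [h4, Nat.cast_le]
    convert h3
    exact Iff.rfl
  rw [h1]
  refine (lintegral_mono h2).trans_eq ?_
  simp [ν]

/-! ### Concentration for a single set -/

/-- Hoeffding's inequality for `-1_C`, whose range `[-1, 0]` gives the variance proxy `1 / 4`. -/
lemma measure_sum_indicator_le {n : ℕ} {Ω : Type*} [MeasurableSpace Ω] {μ : Measure Ω}
    [IsProbabilityMeasure μ] {P : Measure ℝ} {Z : Fin n → Ω → ℝ} (hZ : ∀ i, Measurable (Z i))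
    (hind : iIndepFun Z μ) (hlaw : ∀ i, μ.map (Z i) = P) {C : Set ℝ} (hC : MeasurableSet C)
    {δ : ℝ} (hδ : 0 ≤ δ) :
    μ.real {ω | ∑ i, C.indicator 1 (Z i ω) ≤ n * (P.real C - δ)} ≤ Real.exp (-(2 * n * δ ^ 2)) := by
  rcases Nat.eq_zero_or_pos n with rfl | hn
  · simp
  set g : ℝ → ℝ := fun x => -C.indicator 1 x
  have hg : Measurable g := (measurable_one.indicator hC).neg
  have hint : ∀ i, ∫ ω, g (Z i ω) ∂μ = -P.real C := by
    intro i
    rw [← hlaw i, ← integral_map (hZ i).aemeasurable hg.aestronglyMeasurable, integral_neg,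
      integral_indicator_one hC]
  have hsub : ∀ i ∈ (Finset.univ : Finset (Fin n)),
      HasSubgaussianMGF (fun ω => g (Z i ω) + P.real C) ((‖(0 : ℝ) - (-1)‖₊ / 2) ^ 2) μ := by
    intro i _
    have h := hasSubgaussianMGF_of_mem_Icc (μ := μ) (X := fun ω => g (Z i ω)) (a := -1) (b := 0)
      (hg.comp (hZ i)).aemeasurable (Filter.Eventually.of_forall fun ω => by
        by_cases h : Z i ω ∈ C <;> simp [g, h])
    simpa [hint] using h
  have hind' : iIndepFun (fun i ω => g (Z i ω) + P.real C) μ :=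
    hind.comp (fun _ x => g x + P.real C) fun _ => hg.add_const _
  have h := HasSubgaussianMGF.measure_sum_ge_le_of_iIndepFun hind' hsub (ε := n * δ)
    (by positivity)
  refine le_trans (le_of_eq ?_) (h.trans (le_of_eq ?_))
  · congr 1
    ext ω
    simp only [g, Set.mem_ofPred_eq, Finset.sum_add_distrib, Finset.sum_neg_distrib,
      Finset.sum_const, Finset.card_univ, Fintype.card_fin, nsmul_eq_mul]
    constructor <;> intro h <;> linarith
  · have hn' : (n : ℝ) ≠ 0 := by positivity
    congr 1
    simp
    field_simp

/-! ### The rate -/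

lemma rate_bounds {n k : ℕ} {δ : ℝ} (hn : 0 < n)
    (hδ : 32 * √((k + Real.log n) / n) ≤ δ) :
    0 ≤ δ ∧ 1024 * (k + Real.log n) ≤ n * δ ^ 2 := by
  have hlog : 0 ≤ Real.log n := Real.log_natCast_nonneg n
  have h0 : 0 ≤ δ := le_trans (by positivity) hδ
  refine ⟨h0, ?_⟩
  have h1 : (32 * √((k + Real.log n) / n)) ^ 2 ≤ δ ^ 2 := by gcongr
  rw [mul_pow, Real.sq_sqrt (by positivity)] at h1
  have hn' : (0 : ℝ) < n := by exact_mod_cast hn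
  calc 1024 * (k + Real.log n) = n * (32 ^ 2 * ((k + Real.log n) / n)) := by
        field_simp; ring
    _ ≤ n * δ ^ 2 := by gcongr

lemma exp_neg_log_le {n k : ℕ} {δ : ℝ} (hn : 0 < n) (hk : 0 < k) (h0 : 0 ≤ δ)
    (h : 1024 * (k + Real.log n) ≤ n * δ ^ 2) : Real.exp (-Real.log n) ≤ δ := by
  have hn' : (1 : ℝ) ≤ n := by exact_mod_cast hn
  have hk' : (1 : ℝ) ≤ k := by exact_mod_cast hk
  have hlog : 0 ≤ Real.log n := Real.log_natCast_nonneg n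
  rw [Real.exp_neg, Real.exp_log (by linarith), inv_le_iff_one_le_mul₀' (by linarith)]
  -- If `n * δ < 1`, then `n * δ ^ 2 ≤ (n * δ) ^ 2 < 1`, against `1024 * k ≤ n * δ ^ 2`.
  by_contra hcon
  have h1 : (n * δ) ^ 2 < 1 := by
    have : 0 ≤ (n : ℝ) * δ := by positivity
    exact pow_lt_one₀ this (not_le.1 hcon) two_ne_zero
  have h2 : (n : ℝ) * (n * δ ^ 2) < 1 := by
    calc (n : ℝ) * (n * δ ^ 2) = (n * δ) ^ 2 := by ring
      _ < 1 := h1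
  have h3 : (1 : ℝ) * (n * δ ^ 2) ≤ n * (n * δ ^ 2) := by gcongr
  linarith

lemma measure_badSamples_le_of_rate {n k : ℕ} (P : Measure ℝ) [IsProbabilityMeasure P] {δ : ℝ}
    (hn : 0 < n) (hk : 0 < k) (h0 : 0 ≤ δ) (h1 : δ ≤ 1)
    (h : 1024 * (k + Real.log n) ≤ n * δ ^ 2) :
    (Measure.pi fun _ => P) (badSamples n k (3 * δ * n)) ≤ ENNReal.ofReal δ := by
  have hlog : 0 ≤ Real.log n := Real.log_natCast_nonneg n
  have hn' : (0 : ℝ) < n := by exact_mod_cast hn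
  have hk' : (1 : ℝ) ≤ k := by exact_mod_cast hk
  have hkn : 2 * k < 2 * n + 1 := by
    have hle : (n : ℝ) * δ ^ 2 ≤ n * 1 := by gcongr; exact pow_le_one₀ h0 h1
    have : (k : ℝ) ≤ n := by linarith
    have : k ≤ n := by exact_mod_cast this
    omega
  have hex : ∃ j, 2 * n + 1 ≤ 2 * k * 2 ^ j :=
    ⟨2 * n + 1, (Nat.lt_two_pow_self).le.trans (Nat.le_mul_of_pos_left _ (by omega))⟩
  classical
  -- Minimality of `j` gives `2 * k * 2 ^ j ≤ 4 * n`; `j ≠ 0` because `k ≤ n`.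
  set j := Nat.find hex
  have hj1 : 2 * n + 1 ≤ 2 * k * 2 ^ j := Nat.find_spec hex
  have hj2 : 2 * k * 2 ^ j ≤ 4 * n := by
    have hj0 : j ≠ 0 := by
      intro h0
      rw [h0] at hj1
      omega
    obtain ⟨i, hi⟩ := Nat.exists_eq_succ_of_ne_zero hj0
    have := Nat.find_min hex (m := i) (by omega)
    rw [hi, Nat.succ_eq_add_one, pow_succ, ← mul_assoc]
    omega
  have hj2' : ((2 * k : ℕ) : ℝ) * 2 ^ j ≤ 4 * n := by exact_mod_cast hj2
  -- With `t = log n` the failure probability is `1 / n ≤ δ`. The constant `32` suffices because `96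
  -- / 1024 ≤ (3 / 8) ^ 2`.
  have key := measure_badSamples_le (n := n) (k := k) P (D := 2 * k) (j := j) (t := Real.log n)
    (u := 3 * δ * n / 8) (by omega) le_rfl hj1 hlog (by positivity) (by
      calc 8 * (((2 * k : ℕ) : ℝ) * 2 ^ j) * ((2 * k : ℕ) + 1 + Real.log n)
          ≤ 8 * (4 * n) * (3 * (k + Real.log n)) := by
            gcongr
            push_cast
            linarith
        _ = 96 / 1024 * n * (1024 * (k + Real.log n)) := by ring
        _ ≤ 96 / 1024 * n * (n * δ ^ 2) := by gcongr
        _ ≤ (3 * δ * n / 8) ^ 2 := by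
            have : 0 ≤ (n : ℝ) * (n * δ ^ 2) := by positivity
            nlinarith)
  rw [show 8 * (3 * δ * n / 8) = 3 * δ * (n : ℝ) by ring] at key
  exact key.trans (ENNReal.ofReal_le_ofReal (exp_neg_log_le hn hk h0 h))

/-! ### The two parts of the theorem -/

lemma measurableSet_of_mem_unionsOfIntervals {k : ℕ} {C : Set ℝ} (hC : C ∈ unionsOfIntervals k) :
    MeasurableSet C := by
  obtain ⟨I, hI, rfl⟩ := hC
  exact MeasurableSet.iUnion fun i => (hI i).measurableSet

lemma map_sample_eq_pi {N : ℕ} {Ω : Type*} [MeasurableSpace Ω] {μ : Measure Ω}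
    [IsProbabilityMeasure μ] {P : Measure ℝ} {Y : Fin N → Ω → ℝ} (hY : ∀ i, Measurable (Y i))
    (hind : iIndepFun Y μ) (hlaw : ∀ i, μ.map (Y i) = P) :
    μ.map (fun ω i => Y i ω) = Measure.pi fun _ => P := by
  rw [(iIndepFun_iff_map_fun_eq_pi_map fun i => (hY i).aemeasurable).1 hind]
  simp [hlaw]

lemma coverage {n m : ℕ} {α : ℝ} (hα : 0 ≤ α) {Ω : Type*} [MeasurableSpace Ω] {μ : Measure Ω}
    [IsProbabilityMeasure μ] {P : Measure ℝ} [IsProbabilityMeasure P]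
    {Y : Fin (2 * n + 1) → Ω → ℝ} (hY : ∀ i, Measurable (Y i)) (hind : iIndepFun Y μ)
    (hlaw : ∀ i, μ.map (Y i) = P) {S : Fin m → (Fin n → ℝ) → Set ℝ}
    (hS : ∀ j, MeasurableSet {p : (Fin n → ℝ) × ℝ | p.2 ∈ S j p.1}) :
    1 - α ≤ μ.real {ω | Y (Fin.last (2 * n)) ω ∈ splitConformalSet α S (fun i => Y i ω)} := by
  set r := ⌊((n : ℝ) + 1) * α⌋₊
  set B := lowRank S r (Fin.last n)
  have hB : MeasurableSet B := measurableSet_lowRank hS r _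
  have hYm : Measurable fun ω i => Y i ω := measurable_pi_iff.2 hY
  have h1 : μ.real ((fun ω i => Y i ω) ⁻¹' B) ≤ α := by
    have h2 := measure_lowRank_le P hS r (Fin.last n)
    rw [← map_sample_eq_pi hY hind hlaw, Measure.map_apply hYm hB] at h2
    have h3 := ENNReal.toReal_mono (ENNReal.natCast_ne_top r) h2
    rw [ENNReal.toReal_mul, ENNReal.toReal_natCast, ENNReal.toReal_add (by simp) (by simp),
      ENNReal.toReal_natCast, ENNReal.toReal_one] at h3
    have h4 : (r : ℝ) ≤ ((n : ℝ) + 1) * α := Nat.floor_le (by positivity)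
    exact le_of_mul_le_mul_left (h3.trans h4) (by positivity)
  have h5 : ((fun ω i => Y i ω) ⁻¹' B)ᶜ ⊆
      {ω | Y (Fin.last (2 * n)) ω ∈ splitConformalSet α S (fun i => Y i ω)} := by
    intro ω hω
    by_contra hcon
    exact hω (mem_lowRank_of_notMem hcon)
  have h6 := measureReal_mono (μ := μ) h5
  rw [probReal_compl_eq_one_sub (hYm hB)] at h6
  linarith

lemma splitConformalSet_volume_le {n m k : ℕ} {α δ γ : ℝ} (hn : 0 < n) (hα0 : 0 < α) (hα1 : α < 1)
    {S : Fin m → (Fin n → ℝ) → Set ℝ} {y : Fin (2 * n + 1) → ℝ}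
    (hsys : IsNestedSystem k α δ γ (firstHalf y) fun j => S j (firstHalf y))
    (hy : y ∉ badSamples n k (3 * δ * n)) :
    volume (splitConformalSet α S y) ≤
      optVol k (empirical (firstHalf y)) (1 - α + 1 / n + 3 * δ + γ) := by
  have hn' : (0 : ℝ) < n := by exact_mod_cast hn
  obtain ⟨j, hj, hvol⟩ := hsys.exists_good
  refine (measure_mono (predictionSet_subset hsys.nested j ?_ ?_)).trans hvol
  · refine Nat.lt_succ_iff.1 ((Nat.floor_lt (by positivity)).2 ?_)
    push_cast
    exact mul_lt_of_lt_one_right (by positivity) hα1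
  · have h1 : discrepancy y (S j (firstHalf y)) ≤ 3 * δ * n := by
      by_contra hcon
      exact hy ⟨_, hsys.mem_unions j, not_le.1 hcon⟩
    rw [discrepancy, Finset.sum_sub_distrib] at h1
    rw [empirical_real_eq, le_div_iff₀ hn'] at hj
    -- The term `1 / n` in the level pays for rounding: `(n - α * n + 1) + ⌊(n + 1) * α⌋ > n + α`.
    have h2 := Nat.lt_floor_add_one (((n : ℝ) + 1) * α)
    have h3 : (1 - α + 1 / n + 3 * δ) * n = n - α * n + 1 + 3 * δ * n := by field_simp
    rw [h3] at hj
    linarith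

lemma volume_optimality {n m k : ℕ} {α δ γ : ℝ} (hn : 0 < n) (hk : 0 < k) (hα0 : 0 < α)
    (hα1 : α < 1) (hδ : 32 * √((k + Real.log n) / n) ≤ δ) {Ω : Type*} [MeasurableSpace Ω]
    {μ : Measure Ω} [IsProbabilityMeasure μ] {P : Measure ℝ} [IsProbabilityMeasure P]
    {Y : Fin (2 * n + 1) → Ω → ℝ} (hY : ∀ i, Measurable (Y i)) (hind : iIndepFun Y μ)
    (hlaw : ∀ i, μ.map (Y i) = P) {S : Fin m → (Fin n → ℝ) → Set ℝ}
    (hsys : ∀ᵐ ω ∂μ, IsNestedSystem k α δ γ (firstHalf fun i => Y i ω)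
      (fun j => S j (firstHalf fun i => Y i ω))) :
    1 - 2 * δ ≤ μ.real {ω | volume (splitConformalSet α S (fun i => Y i ω)) ≤
      optVol k P (1 - α + 1 / n + 4 * δ + γ)} := by
  have hn' : (0 : ℝ) < n := by exact_mod_cast hn
  obtain ⟨h0, hrate⟩ := rate_bounds hn hδ
  -- A nested system exists for some outcome, and its good set has empirical mass at most `1`.
  have h1 : δ ≤ 1 := by
    obtain ⟨ω, hω⟩ := hsys.exists
    obtain ⟨j, hj, -⟩ := hω.exists_good
    have hle : (empirical (firstHalf fun i => Y i ω)).real (S j (firstHalf fun i => Y i ω)) ≤ 1 := by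
      rw [empirical_real_eq, div_le_one hn']
      refine (Finset.sum_le_card_nsmul _ _ 1 fun i _ => ?_).trans (by simp)
      exact Set.indicator_le_self' (fun _ _ => zero_le_one) _
    have : 0 ≤ 1 / (n : ℝ) := by positivity
    linarith
  set A := {ω | volume (splitConformalSet α S (fun i => Y i ω)) ≤
      optVol k P (1 - α + 1 / n + 4 * δ + γ)}
  suffices hA : μ Aᶜ ≤ ENNReal.ofReal (2 * δ) by
    have h2 : μ.real Aᶜ ≤ 2 * δ := ENNReal.toReal_le_of_le_ofReal (by positivity) hA
    -- Subadditivity replaces the complement rule, so measurability of `A` is not needed.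
    have h3 := measureReal_union_le (μ := μ) A Aᶜ
    rw [Set.union_compl_self, probReal_univ] at h3
    linarith
  set V : Set ENNReal := volume ''
    {C : Set ℝ | C ∈ unionsOfIntervals k ∧ 1 - α + 1 / n + 4 * δ + γ ≤ P.real C}
  have hopt : optVol k P (1 - α + 1 / n + 4 * δ + γ) = sInf V := sInf_image.symm
  rcases V.eq_empty_or_nonempty with hemp | hne
  · have : Aᶜ = ∅ := by
      rw [Set.compl_empty_iff, Set.eq_univ_iff_forall]
      intro ω
      change volume _ ≤ _
      rw [hopt, hemp, sInf_empty]
      exact le_top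
    simp [this]
  obtain ⟨v, -, hv, hvV⟩ := exists_seq_tendsto_sInf hne (OrderBot.bddBelow V)
  choose C hC hCv using hvV
  set F : ℕ → Set Ω := fun l =>
    {ω | ∑ i, (C l).indicator 1 (firstHalf (fun i => Y i ω) i) ≤ n * (P.real (C l) - δ)}
  have hF : ∀ l, μ (F l) ≤ ENNReal.ofReal δ := by
    intro l
    have h := measure_sum_indicator_le (μ := μ) (P := P) (Z := fun i : Fin n => Y ⟨i, by omega⟩)
      (fun i => hY _) (hind.precomp fun a b h => by simpa [Fin.ext_iff] using h)
      (fun i => hlaw _) (measurableSet_of_mem_unionsOfIntervals (hC l).1) h0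
    rw [← ENNReal.ofReal_toReal (measure_ne_top μ (F l))]
    refine ENNReal.ofReal_le_ofReal (h.trans (le_trans ?_ (exp_neg_log_le hn hk h0 hrate)))
    rw [Real.exp_le_exp]
    have : (0 : ℝ) ≤ k := by positivity
    have : 0 ≤ Real.log n := Real.log_natCast_nonneg n
    linarith
  set B := (fun ω i => Y i ω) ⁻¹' badSamples n k (3 * δ * n)
  have hB : μ B ≤ ENNReal.ofReal δ := by
    have h := measure_badSamples_le_of_rate P hn hk h0 h1 hrate
    rwa [← map_sample_eq_pi hY hind hlaw, Measure.map_apply (measurable_pi_iff.2 hY)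
      (measurableSet_badSamples _ _ _)] at h
  -- The infimum may not be attained. Outside `L` the Hoeffding bound holds for infinitely many `l`,
  -- which suffices in the limit. As an increasing union of subsets of the `F N`, the set `L` costs
  -- only one `δ`.
  set L : Set Ω := ⋃ N, ⋂ l ≥ N, F l
  have hL : μ L ≤ ENNReal.ofReal δ := by
    have hmono : Monotone fun N => ⋂ l ≥ N, F l := fun a b hab =>
      Set.biInter_subset_biInter_left fun l hl => le_trans hab hl
    rw [hmono.measure_iUnion]
    exact iSup_le fun N => (measure_mono (Set.biInter_subset_of_mem (le_refl N))).trans (hF N)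
  have hsub : Aᶜ ≤ᵐ[μ] (B ∪ L : Set Ω) := by
    filter_upwards [hsys] with ω hω hωA
    by_contra hcon
    have hωB : ω ∉ B := fun h => hcon (Or.inl h)
    have hωL : ω ∉ L := fun h => hcon (Or.inr h)
    refine hωA ?_
    change volume _ ≤ _
    rw [hopt]
    have hle := splitConformalSet_volume_le hn hα0 hα1 hω hωB
    refine ge_of_tendsto_of_frequently hv (Filter.frequently_atTop.2 fun N => ?_)
    simp only [L, Set.mem_iUnion, Set.mem_iInter, not_exists, not_forall] at hωL
    obtain ⟨l, hl, hlF⟩ := hωL N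
    refine ⟨l, hl, hle.trans ?_⟩
    rw [← hCv l]
    refine iInf₂_le (C l) ⟨(hC l).1, ?_⟩
    have h2 : n * (P.real (C l) - δ) <
        ∑ i, (C l).indicator 1 (firstHalf (fun i => Y i ω) i) := not_le.1 hlF
    rw [empirical_real_eq, le_div_iff₀ hn']
    refine le_trans ?_ h2.le
    rw [mul_comm]
    have := (hC l).2
    gcongr
    linarith
  calc μ Aᶜ ≤ μ (B ∪ L) := measure_mono_ae hsub
    _ ≤ μ B + μ L := measure_union_le _ _
    _ ≤ ENNReal.ofReal δ + ENNReal.ofReal δ := add_le_add hB hL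
    _ = ENNReal.ofReal (2 * δ) := by rw [← ENNReal.ofReal_add h0 h0, two_mul]

end ConformalDP

theorem theorem2p2 :
    ∃ c : ℝ, 0 < c ∧
      ∀ (n m k : ℕ) (α δ γ : ℝ), 0 < n → 0 < k → 0 < α → α < 1 →
      3 * δ + γ + 1 / n ≤ α →
      c * √((k + Real.log n) / n) ≤ δ →
      ∀ (P : Measure ℝ) [IsProbabilityMeasure P]
        (Ω : Type*) [MeasurableSpace Ω] (μ : Measure Ω) [IsProbabilityMeasure μ]
        (Y : Fin (2 * n + 1) → Ω → ℝ),
      (∀ i, Measurable (Y i)) → iIndepFun Y μ → (∀ i, μ.map (Y i) = P) →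
      ∀ S : Fin m → (Fin n → ℝ) → Set ℝ,
      (∀ j, MeasurableSet {p : (Fin n → ℝ) × ℝ | p.2 ∈ S j p.1}) →
      (∀ᵐ ω ∂μ, ConformalDP.IsNestedSystem k α δ γ
        (ConformalDP.firstHalf fun i => Y i ω)
        (fun j => S j (ConformalDP.firstHalf fun i => Y i ω))) →
      1 - α ≤ μ.real {ω | Y (Fin.last (2 * n)) ω ∈
          ConformalDP.splitConformalSet α S (fun i => Y i ω)} ∧
      1 - 2 * δ ≤ μ.real {ω |
          volume (ConformalDP.splitConformalSet α S (fun i => Y i ω)) ≤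
            ConformalDP.optVol k P (1 - α + 1 / n + 4 * δ + γ)} := by
  refine ⟨32, by norm_num, ?_⟩
  intro n m k α δ γ hn hk hα0 hα1 _ hδ P _ Ω _ μ _ Y hY hind hlaw S hS hsys
  exact ⟨ConformalDP.coverage hα0.le hY hind hlaw hS,
    ConformalDP.volume_optimality hn hk hα0 hα1 hδ hY hind hlaw hsys⟩
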